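/- All rings are associative with identity and all modules are unitary. Let $A$ and $B$ be rings, let $U$ be a $(B,A)$-bimodule, and let $T=\begin{pmatrix}A&0\\U&B\end{pmatrix}$ be the triangular matrix ring. A triple $(M_1,M_2,\varphi^M)$ of a left $A$-module $M_1$, a left $B$-module $M_2$ and a $B$-homomorphism $\varphi^M:U\otimes_A M_1\to M_2$ is identified with the left $T$-module of columns $\binom{m_1}{m_2}$, $m_i\in M_i$, with action $$\begin{pmatrix}a&0\\u&b\end{pmatrix}\binom{m_1}{m_2}=\binom{am_1}{\varphi^M(u\otimes m_1)+bm_2}.$$ A left module $M$ over a ring $R$ is *Gorenstein flat* if there is an exact sequence $\cdots\to F^{-1}\to F^0\to F^1\to\cdots$ of flat left $R$-modules, indexed by $\mathbb Z$, with $M\cong\operatorname{Ker}(F^0\to F^1)$, which remains exact after applying $I\otimes_R-$ for every injective right $R$-module $I$. A Grothendieck category is *Gorenstein* if (1) its objects of finite projective dimension are exactly its objects of finite injective dimension; (2) its finitistic projective and finitistic injective dimensions (the suprema of the finite projective, respectively injective, dimensions of its objects) are finite; (3) it has a generator of finite projective dimension. A ring $R$ is *right Gorenstein regular* if the category of right $R$-modules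 is Gorenstein. **Proposition 3.6.** Assume that $U$ has finite projective dimension as a right $A$-module and as a left $B$-module, and that $T$ is right Gorenstein regular. Let $M=(M_1,M_2,\varphi^M)$ be a left $T$-module. If $M$ is Gorenstein flat over $T$, then $M_1$ is a Gorenstein flat left $A$-module, $M_2/\operatorname{Im}\varphi^M$ is a Gorenstein flat left $B$-module, and $\varphi^M$ is injective. -/

import Mathlib

open CategoryTheory

universe u v w w'

namespace GorTri

/-! ### Tensor products over an arbitrary (noncommutative) ring

A right `R`-module is a module over `Rᵐᵒᵖ`, with `x r` written `MulOpposite.op r • x`. -/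

section BalTensor

variable (R : Type u) [Ring R]
variable (X : Type v) [AddCommGroup X] [Module Rᵐᵒᵖ X]
variable (Y : Type w) [AddCommGroup Y] [Module R Y]

/-- The subgroup of `X ⊗_ℤ Y` generated by the elements `x r ⊗ y - x ⊗ r y`. -/
def balRel : AddSubgroup (TensorProduct ℤ X Y) :=
  AddSubgroup.closure {t | ∃ (x : X) (r : R) (y : Y),
    t = TensorProduct.tmul ℤ (MulOpposite.op r • x) y - TensorProduct.tmul ℤ x (r • y)}

/-- The tensor product `X ⊗_R Y` of a right `R`-module `X` and a left `R`-module `Y`,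
an abelian group. -/
def BalTensor : Type (max v w) := TensorProduct ℤ X Y ⧸ balRel R X Y

instance : AddCommGroup (BalTensor R X Y) :=
  inferInstanceAs (AddCommGroup (TensorProduct ℤ X Y ⧸ balRel R X Y))

/-- The projection `X ⊗_ℤ Y → X ⊗_R Y`. -/
def balMk : TensorProduct ℤ X Y →+ BalTensor R X Y := QuotientAddGroup.mk' (balRel R X Y)

variable {X Y}

/-- The pure tensor `x ⊗ y` in `X ⊗_R Y`. -/
def btmul (x : X) (y : Y) : BalTensor R X Y := balMk R X Y (TensorProduct.tmul ℤ x y)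

variable {R}

theorem btmul_add (x : X) (y y' : Y) :
    btmul R x (y + y') = btmul R x y + btmul R x y' := by
  simp only [btmul, TensorProduct.tmul_add, map_add]

theorem add_btmul (x x' : X) (y : Y) :
    btmul R (x + x') y = btmul R x y + btmul R x' y := by
  simp only [btmul, TensorProduct.add_tmul, map_add]

@[simp] theorem btmul_zero (x : X) : btmul R x (0 : Y) = 0 := by
  simp only [btmul, TensorProduct.tmul_zero, map_zero]

@[simp] theorem zero_btmul (y : Y) : btmul R (0 : X) y = 0 := by
  simp only [btmul, TensorProduct.zero_tmul, map_zero]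

theorem btmul_balanced (x : X) (r : R) (y : Y) :
    btmul R (MulOpposite.op r • x) y = btmul R x (r • y) := by
  refine sub_eq_zero.1 ?_
  rw [btmul, btmul, ← map_sub]
  exact (QuotientAddGroup.eq_zero_iff _).2 (AddSubgroup.subset_closure ⟨x, r, y, rfl⟩)

/-- Two additive maps out of `X ⊗_R Y` that agree on pure tensors are equal. -/
theorem balTensor_hom_ext {P : Type w'} [AddCommGroup P] {f g : BalTensor R X Y →+ P}
    (h : ∀ x y, f (btmul R x y) = g (btmul R x y)) : f = g := by
  refine AddMonoidHom.ext fun t => ?_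
  obtain ⟨s, rfl⟩ := QuotientAddGroup.mk'_surjective (balRel R X Y) t
  change f (balMk R X Y s) = g (balMk R X Y s)
  induction s with
  | zero => simp only [map_zero]
  | tmul x y => exact h x y
  | add a b ha hb => simp only [map_add, ha, hb]

/-- The homomorphism `f ⊗ g : X ⊗_R Y → X' ⊗_R Y'` induced by a homomorphism `f` of right modules
and a homomorphism `g` of left modules. -/
def bmap {X' : Type*} [AddCommGroup X'] [Module Rᵐᵒᵖ X'] {Y' : Type*} [AddCommGroup Y']
    [Module R Y'] (f : X →ₗ[Rᵐᵒᵖ] X') (g : Y →ₗ[R] Y') :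
    BalTensor R X Y →+ BalTensor R X' Y' :=
  QuotientAddGroup.map (balRel R X Y) (balRel R X' Y')
    (TensorProduct.map f.toAddMonoidHom.toIntLinearMap
      g.toAddMonoidHom.toIntLinearMap).toAddMonoidHom (by
        rw [balRel, AddSubgroup.closure_le]
        rintro _ ⟨x, r, y, rfl⟩
        refine AddSubgroup.subset_closure ⟨f x, r, g y, ?_⟩
        simp)

@[simp] theorem bmap_btmul {X' : Type*} [AddCommGroup X'] [Module Rᵐᵒᵖ X'] {Y' : Type*}
    [AddCommGroup Y'] [Module R Y'] (f : X →ₗ[Rᵐᵒᵖ] X') (g : Y →ₗ[R] Y') (x : X) (y : Y) :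
    bmap f g (btmul R x y) = btmul R (f x) (g y) := rfl

section LeftModule

variable {S : Type*} [Ring S] [Module S X] [SMulCommClass S Rᵐᵒᵖ X]

/-- Left multiplication by `s` on an `(S, R)`-bimodule, as a homomorphism of right modules. -/
def leftMul (s : S) : X →ₗ[Rᵐᵒᵖ] X where
  toFun x := s • x
  map_add' := smul_add s
  map_smul' r x := smul_comm s r x

/-- If `X` is an `(S, R)`-bimodule then `X ⊗_R Y` is a left `S`-module, by
`s (x ⊗ y) = (s x) ⊗ y`. -/
instance balTensorModule : Module S (BalTensor R X Y) where
  smul s t := bmap (leftMul s) LinearMap.id t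
  one_smul t := DFunLike.congr_fun (f := bmap (leftMul (1 : S)) LinearMap.id)
    (g := AddMonoidHom.id _) (balTensor_hom_ext fun x y => by simp [leftMul]) t
  mul_smul s s' t := DFunLike.congr_fun (f := bmap (leftMul (s * s')) LinearMap.id)
    (g := (bmap (leftMul s) LinearMap.id).comp (bmap (leftMul s') LinearMap.id))
    (balTensor_hom_ext fun x y => by simp [leftMul, mul_smul]) t
  smul_zero s := map_zero (bmap (leftMul s) LinearMap.id)
  smul_add s := map_add (bmap (leftMul s) LinearMap.id)
  add_smul s s' t := DFunLike.congr_fun (f := bmap (leftMul (s + s')) LinearMap.id)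
    (g := bmap (leftMul s) LinearMap.id + bmap (leftMul s') LinearMap.id)
    (balTensor_hom_ext fun x y => by simp [leftMul, add_smul, add_btmul]) t
  zero_smul t := DFunLike.congr_fun (f := bmap (leftMul (0 : S)) LinearMap.id)
    (g := 0) (balTensor_hom_ext fun x y => by
      simp [leftMul, zero_btmul]) t

theorem smul_btmul (s : S) (x : X) (y : Y) : s • btmul R x y = btmul R (s • x) y := rfl

end LeftModule

end BalTensor

/-! ### Flat and Gorenstein flat modules -/

section GorensteinFlat

variable (R : Type u) [Ring R] (M : Type u) [AddCommGroup M] [Module R M]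

/-- A left `R`-module `M` is flat if `- ⊗_R M` preserves injectivity of homomorphisms of
right `R`-modules. -/
def IsFlat : Prop :=
  ∀ (X Y : Type u) [AddCommGroup X] [Module Rᵐᵒᵖ X] [AddCommGroup Y] [Module Rᵐᵒᵖ Y]
    (f : X →ₗ[Rᵐᵒᵖ] Y), Function.Injective f →
      Function.Injective (bmap f (LinearMap.id : M →ₗ[R] M))

/-- A left `R`-module `M` is Gorenstein flat if there is an exact sequence
`⋯ → F (-1) → F 0 → F 1 → ⋯` of flat left `R`-modules, with `M ≅ Ker (F 0 → F 1)`, which stays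
exact under `I ⊗_R -` for every injective right `R`-module `I`. -/
def IsGorensteinFlat : Prop :=
  ∃ (F : ℤ → ModuleCat.{u} R) (d : ∀ n : ℤ, F n →ₗ[R] F (n + 1)),
    (∀ n, IsFlat R (F n)) ∧
    (∀ n, Function.Exact (d n) (d (n + 1))) ∧
    Nonempty (M ≃ₗ[R] LinearMap.ker (d 0)) ∧
    ∀ (I : Type u) [AddCommGroup I] [Module Rᵐᵒᵖ I], Module.Injective Rᵐᵒᵖ I →
      ∀ n, Function.Exact (bmap (LinearMap.id : I →ₗ[Rᵐᵒᵖ] I) (d n))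
        (bmap (LinearMap.id : I →ₗ[Rᵐᵒᵖ] I) (d (n + 1)))

end GorensteinFlat

/-! ### Finite homological dimensions, Gorenstein categories, Gorenstein regular rings -/

section Gorenstein

variable {C : Type u} [Category.{v} C] [Abelian C]

/-- The object `X` has finite projective dimension. -/
def FinitePD (X : C) : Prop := ∃ n : ℕ, HasProjectiveDimensionLE X n

/-- The object `X` has finite injective dimension. -/
def FiniteID (X : C) : Prop := ∃ n : ℕ, HasInjectiveDimensionLE X n

variable (C) in
/-- A Grothendieck category is Gorenstein if its objects of finite projective dimension are
exactly those of finite injective dimension, its finitistic projective and injective dimensions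
are finite, and it has a generator of finite projective dimension. -/
structure IsGorensteinCategory [IsGrothendieckAbelian.{w} C] : Prop where
  finitePD_iff_finiteID : ∀ X : C, FinitePD X ↔ FiniteID X
  finitistic_projective : ∃ N : ℕ, ∀ X : C, FinitePD X → HasProjectiveDimensionLE X N
  finitistic_injective : ∃ N : ℕ, ∀ X : C, FiniteID X → HasInjectiveDimensionLE X N
  generator : ∃ G : C, IsSeparator G ∧ FinitePD G

/-- A ring `R` is right Gorenstein regular if the category of right `R`-modules is Gorenstein. -/
def IsRightGorensteinRegular (R : Type u) [Ring R] : Prop :=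
  IsGorensteinCategory.{u + 1, u, u} (ModuleCat.{u} Rᵐᵒᵖ)

end Gorenstein

/-! ### The triangular matrix ring and its modules -/

section Triangular

/-- The matrices `(a 0; u b)` with `a ∈ A`, `u ∈ U`, `b ∈ B`. -/
@[ext] structure TriRing (A B U : Type u) where
  a : A
  u : U
  b : B

namespace TriRing

/-- Matrices as triples of entries. -/
def equivProd (A B U : Type u) : TriRing A B U ≃ A × U × B where
  toFun t := (t.a, t.u, t.b)
  invFun p := ⟨p.1, p.2.1, p.2.2⟩
  left_inv _ := rfl
  right_inv _ := rfl

section Additive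

variable {A B U : Type u} [AddCommGroup A] [AddCommGroup B] [AddCommGroup U]

/-- Matrices are added entrywise. -/
instance : AddCommGroup (TriRing A B U) := (equivProd A B U).addCommGroup

@[simp] theorem zero_a : (0 : TriRing A B U).a = 0 := rfl
@[simp] theorem zero_u : (0 : TriRing A B U).u = 0 := rfl
@[simp] theorem zero_b : (0 : TriRing A B U).b = 0 := rfl
@[simp] theorem add_a (s t : TriRing A B U) : (s + t).a = s.a + t.a := rfl
@[simp] theorem add_u (s t : TriRing A B U) : (s + t).u = s.u + t.u := rfl
@[simp] theorem add_b (s t : TriRing A B U) : (s + t).b = s.b + t.b := rfl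

end Additive

section One

variable {A B U : Type u} [Ring A] [Ring B] [AddCommGroup U]

/-- The identity matrix. -/
instance : One (TriRing A B U) := ⟨⟨1, 0, 1⟩⟩

@[simp] theorem one_a : (1 : TriRing A B U).a = 1 := rfl
@[simp] theorem one_u : (1 : TriRing A B U).u = 0 := rfl
@[simp] theorem one_b : (1 : TriRing A B U).b = 1 := rfl

end One

variable {A B U : Type u} [Ring A] [Ring B] [AddCommGroup U] [Module B U] [Module Aᵐᵒᵖ U]

/-- Matrix multiplication: the lower left entry of a product is `u a' + b u'`. -/
instance : Mul (TriRing A B U) :=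
  ⟨fun s t => ⟨s.a * t.a, MulOpposite.op t.a • s.u + s.b • t.u, s.b * t.b⟩⟩

@[simp] theorem mul_a (s t : TriRing A B U) : (s * t).a = s.a * t.a := rfl
@[simp] theorem mul_u (s t : TriRing A B U) :
    (s * t).u = MulOpposite.op t.a • s.u + s.b • t.u := rfl
@[simp] theorem mul_b (s t : TriRing A B U) : (s * t).b = s.b * t.b := rfl

/-- The triangular matrix ring `T = (A 0; U B)` of a `(B, A)`-bimodule `U`. -/
instance [SMulCommClass B Aᵐᵒᵖ U] : Ring (TriRing A B U) :=
  { (inferInstance : AddCommGroup (TriRing A B U)),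
    (inferInstance : Mul (TriRing A B U)),
    (inferInstance : One (TriRing A B U)) with
    left_distrib := fun r s t => by
      ext <;> simp [mul_add, add_smul]
      abel
    right_distrib := fun r s t => by
      ext <;> simp [add_mul, add_smul]
      abel
    zero_mul := fun t => by ext <;> simp
    mul_zero := fun t => by ext <;> simp
    mul_assoc := fun r s t => by
      ext <;> simp [mul_assoc, mul_smul, add_assoc, smul_comm]
    one_mul := fun t => by ext <;> simp
    mul_one := fun t => by ext <;> simp }

end TriRing

variable {A B U : Type u} [Ring A] [Ring B] [AddCommGroup U] [Module B U] [Module Aᵐᵒᵖ U]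
  [SMulCommClass B Aᵐᵒᵖ U]
variable {M₁ M₂ : Type u} [AddCommGroup M₁] [Module A M₁] [AddCommGroup M₂] [Module B M₂]

/-- The left module over `T = (A 0; U B)` given by a triple `(M₁, M₂, φ)` with
`φ : U ⊗_A M₁ → M₂` a homomorphism of left `B`-modules: the group of columns `(m₁; m₂)`. -/
@[nolint unusedArguments]
def TriModule (_φ : BalTensor A U M₁ →ₗ[B] M₂) : Type u := M₁ × M₂

namespace TriModule

variable (φ : BalTensor A U M₁ →ₗ[B] M₂)

instance : AddCommGroup (TriModule φ) := inferInstanceAs (AddCommGroup (M₁ × M₂))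

/-- The action `(a 0; u b) (m₁; m₂) = (a m₁; φ (u ⊗ m₁) + b m₂)`. -/
instance : SMul (TriRing A B U) (TriModule φ) :=
  ⟨fun t m => (t.a • m.1, φ (btmul A t.u m.1) + t.b • m.2)⟩

@[simp] theorem zero_fst : (0 : TriModule φ).1 = 0 := rfl
@[simp] theorem zero_snd : (0 : TriModule φ).2 = 0 := rfl
@[simp] theorem add_fst (m n : TriModule φ) : (m + n).1 = m.1 + n.1 := rfl
@[simp] theorem add_snd (m n : TriModule φ) : (m + n).2 = m.2 + n.2 := rfl
@[simp] theorem smul_fst (t : TriRing A B U) (m : TriModule φ) : (t • m).1 = t.a • m.1 := rfl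
@[simp] theorem smul_snd (t : TriRing A B U) (m : TriModule φ) :
    (t • m).2 = φ (btmul A t.u m.1) + t.b • m.2 := rfl

instance : Module (TriRing A B U) (TriModule φ) where
  one_smul m := Prod.ext (by simp) (by simp)
  mul_smul s t m := Prod.ext (by simp [mul_smul]) (by
    simp [mul_smul, add_btmul, btmul_balanced, ← smul_btmul, add_assoc])
  smul_zero t := Prod.ext (by simp) (by simp)
  smul_add t m n := Prod.ext (by simp) (by
    simp [btmul_add]
    abel)
  add_smul s t m := Prod.ext (by simp [add_smul]) (by
    simp [add_btmul, add_smul]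
    abel)
  zero_smul m := Prod.ext (by simp) (by simp)

end TriModule

end Triangular

end GorTri

open GorTri

/-! Both corners of `T` are base changes: `A ⊗_T M ≅ M₁` and `B ⊗_T M ≅ M₂ / Im φ` (`extendProjA`,
`extendProjB`). The first two claims therefore follow from `IsGorensteinFlat.extend`: if `ρ : T → S`
makes `S` a module of finite projective dimension on both sides, then `S ⊗_T -` preserves Gorenstein
flatness.

Let `F` be a complex of flats witnessing that `M` is Gorenstein flat. Tensoring a short exact
sequence of right modules with `F` gives a short exact sequence of complexes, so exactness of `X ⊗_T
F` has two out of three in `X`. Hence it holds for every `X` of finite projective dimension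
(`TensorExact.of_finitePD`). For `X = S` this makes `S ⊗_T F` an exact complex of flats with `S ⊗_T
M` as its cycles. An injective right `S`-module `I` is a retract of `Hom_ℤ(S, D)` with `D` an
injective group. Dualizing a finite projective resolution of the left `T`-module `S` gives a finite
injective coresolution of this dual, and so `I ⊗_T F` is exact as well (`TensorExact.dual`).

For `φ`, regard `U` as an ideal of `T`. Up to isomorphism, `φ` is the map `U ⊗_T M → T ⊗_T M`
followed by the inclusion of `M₂` in `M`. It is injective because `U ⊗_T M` embeds in `U ⊗_T F 0`,
which embeds in `T ⊗_T F 0` by flatness. -/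

namespace GorTri

/-! ### Homomorphisms out of balanced tensor products -/

section Tensor

variable {R : Type*} [Ring R]
variable {X : Type*} [AddCommGroup X] [Module Rᵐᵒᵖ X]
variable {X' : Type*} [AddCommGroup X'] [Module Rᵐᵒᵖ X']
variable {X'' : Type*} [AddCommGroup X''] [Module Rᵐᵒᵖ X'']
variable {Y : Type*} [AddCommGroup Y] [Module R Y]
variable {Y' : Type*} [AddCommGroup Y'] [Module R Y']
variable {Y'' : Type*} [AddCommGroup Y''] [Module R Y'']

/-- The homomorphism out of `X ⊗_R Y` induced by a balanced biadditive map. -/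
def balLift {P : Type*} [AddCommGroup P] (f : X →+ Y →+ P)
    (hf : ∀ x (r : R) y, f (MulOpposite.op r • x) y = f x (r • y)) : BalTensor R X Y →+ P :=
  QuotientAddGroup.lift (balRel R X Y)
    (TensorProduct.liftAddHom f fun n x y => by simp) (by
      rw [balRel, AddSubgroup.closure_le]
      rintro _ ⟨x, r, y, rfl⟩
      simp [hf])

@[simp] theorem balLift_btmul {P : Type*} [AddCommGroup P] (f : X →+ Y →+ P)
    (hf : ∀ x (r : R) y, f (MulOpposite.op r • x) y = f x (r • y)) (x : X) (y : Y) :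
    balLift f hf (btmul R x y) = f x y := rfl

theorem balTensor_induction {p : BalTensor R X Y → Prop} (zero : p 0)
    (tmul : ∀ x y, p (btmul R x y)) (add : ∀ s t, p s → p t → p (s + t)) (t) : p t := by
  obtain ⟨s, rfl⟩ := QuotientAddGroup.mk'_surjective (balRel R X Y) t
  change p (balMk R X Y s)
  induction s with
  | zero => simpa using zero
  | tmul x y => exact tmul x y
  | add a b ha hb => simpa using add _ _ ha hb

theorem balTensor_congr {P : Type*} [AddCommGroup P] (f g : BalTensor R X Y →+ P)
    (h : ∀ x y, f (btmul R x y) = g (btmul R x y)) (t : BalTensor R X Y) : f t = g t :=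
  DFunLike.congr_fun (balTensor_hom_ext h) t

theorem bmap_bmap (f : X →ₗ[Rᵐᵒᵖ] X') (g : Y →ₗ[R] Y') (f' : X' →ₗ[Rᵐᵒᵖ] X'')
    (g' : Y' →ₗ[R] Y'') (t : BalTensor R X Y) :
    bmap f' g' (bmap f g t) = bmap (f' ∘ₗ f) (g' ∘ₗ g) t :=
  balTensor_congr ((bmap f' g').comp (bmap f g)) (bmap (f' ∘ₗ f) (g' ∘ₗ g)) (fun _ _ => rfl) t

@[simp] theorem bmap_id (t : BalTensor R X Y) :
    bmap (LinearMap.id : X →ₗ[Rᵐᵒᵖ] X) (LinearMap.id : Y →ₗ[R] Y) t = t :=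
  balTensor_congr (bmap LinearMap.id LinearMap.id) (AddMonoidHom.id _) (fun _ _ => rfl) t

theorem bmap_comm (f : X →ₗ[Rᵐᵒᵖ] X') (g : Y →ₗ[R] Y') (t : BalTensor R X Y) :
    bmap f LinearMap.id (bmap LinearMap.id g t) = bmap LinearMap.id g (bmap f LinearMap.id t) := by
  simp only [bmap_bmap, LinearMap.comp_id, LinearMap.id_comp]

theorem bmap_surjective {f : X →ₗ[Rᵐᵒᵖ] X'} {g : Y →ₗ[R] Y'} (hf : Function.Surjective f)
    (hg : Function.Surjective g) : Function.Surjective (bmap f g) := by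
  intro t
  induction t using balTensor_induction with
  | zero => exact ⟨0, map_zero _⟩
  | tmul x y =>
    obtain ⟨x, rfl⟩ := hf x
    obtain ⟨y, rfl⟩ := hg y
    exact ⟨btmul R x y, rfl⟩
  | add s t hs ht =>
    obtain ⟨s, rfl⟩ := hs
    obtain ⟨t, rfl⟩ := ht
    exact ⟨s + t, map_add _ _ _⟩

/-- The tensor product `X ⊗_R -` is right exact. -/
theorem bmap_exact_right {f : Y →ₗ[R] Y'} {g : Y' →ₗ[R] Y''} (h : Function.Exact f g)
    (hg : Function.Surjective g) :
    Function.Exact (bmap (LinearMap.id : X →ₗ[Rᵐᵒᵖ] X) f)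
      (bmap (LinearMap.id : X →ₗ[Rᵐᵒᵖ] X) g) := by
  intro t
  constructor
  · intro ht
    let N := (bmap (LinearMap.id : X →ₗ[Rᵐᵒᵖ] X) f).range
    let q := QuotientAddGroup.mk' N
    -- Modulo the image of `X ⊗ Y`, the class of `x ⊗ y` depends only on `g y`. A set-theoretic
    -- section of `g` therefore suffices to define an additive map `inv` back from `X ⊗ Y''`.
    have key : ∀ x y y', g y = g y' → q (btmul R x y) = q (btmul R x y') := by
      intro x y y' e
      obtain ⟨z, hz⟩ := (h (y - y')).1 (by rw [map_sub, e, sub_self])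
      rw [show y = f z + y' by rw [hz, sub_add_cancel], btmul_add, map_add, add_eq_right]
      exact (QuotientAddGroup.eq_zero_iff _).2 ⟨btmul R x z, rfl⟩
    let σ := Function.surjInv hg
    have hσ : ∀ y, g (σ y) = y := Function.surjInv_eq hg
    let inv : BalTensor R X Y'' →+ BalTensor R X Y' ⧸ N := balLift
      (AddMonoidHom.mk' (fun x => AddMonoidHom.mk' (fun y => q (btmul R x (σ y)))
        fun y y' => by
          rw [← map_add, ← btmul_add]
          exact key _ _ _ (by simp [hσ]))
        fun x x' => by
          ext y
          simp [add_btmul])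
      (fun x r y => by
        simp only [AddMonoidHom.mk'_apply, btmul_balanced]
        exact key _ _ _ (by simp [hσ]))
    have hinv : inv (bmap LinearMap.id g t) = q t :=
      balTensor_congr (inv.comp (bmap LinearMap.id g)) q (fun x y => key _ _ _ (hσ _)) t
    rw [ht, map_zero] at hinv
    exact (QuotientAddGroup.eq_zero_iff _).1 hinv.symm
  · rintro ⟨s, rfl⟩
    rw [bmap_bmap, h.linearMap_comp_eq_zero]
    exact balTensor_congr _ 0 (fun x y => by simp) s

/-- The tensor product `- ⊗_R Y` is right exact. -/
theorem bmap_exact_left {f : X →ₗ[Rᵐᵒᵖ] X'} {g : X' →ₗ[Rᵐᵒᵖ] X''} (h : Function.Exact f g)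
    (hg : Function.Surjective g) :
    Function.Exact (bmap f (LinearMap.id : Y →ₗ[R] Y)) (bmap g (LinearMap.id : Y →ₗ[R] Y)) := by
  intro t
  constructor
  · intro ht
    let N := (bmap f (LinearMap.id : Y →ₗ[R] Y)).range
    let q := QuotientAddGroup.mk' N
    have key : ∀ x x' y, g x = g x' → q (btmul R x y) = q (btmul R x' y) := by
      intro x x' y e
      obtain ⟨z, hz⟩ := (h (x - x')).1 (by rw [map_sub, e, sub_self])
      rw [show x = f z + x' by rw [hz, sub_add_cancel], add_btmul, map_add, add_eq_right]
      exact (QuotientAddGroup.eq_zero_iff _).2 ⟨btmul R z y, rfl⟩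
    let σ := Function.surjInv hg
    have hσ : ∀ x, g (σ x) = x := Function.surjInv_eq hg
    let inv : BalTensor R X'' Y →+ BalTensor R X' Y ⧸ N := balLift
      (AddMonoidHom.mk' (fun x => AddMonoidHom.mk' (fun y => q (btmul R (σ x) y))
        fun y y' => by rw [← map_add, ← btmul_add])
        fun x x' => by
          ext y
          simp only [AddMonoidHom.mk'_apply, AddMonoidHom.add_apply]
          rw [← map_add, ← add_btmul]
          exact key _ _ _ (by simp [hσ]))
      (fun x r y => by
        simp only [AddMonoidHom.mk'_apply, ← btmul_balanced]
        exact key _ _ _ (by simp [hσ]))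
    have hinv : inv (bmap g LinearMap.id t) = q t :=
      balTensor_congr (inv.comp (bmap g LinearMap.id)) q (fun x y => key _ _ _ (hσ _)) t
    rw [ht, map_zero] at hinv
    exact (QuotientAddGroup.eq_zero_iff _).1 hinv.symm
  · rintro ⟨s, rfl⟩
    rw [bmap_bmap, h.linearMap_comp_eq_zero]
    exact balTensor_congr _ 0 (fun x y => by simp) s

/-- The isomorphism `R ⊗_R Y ≅ Y`. -/
def ringBalTensor : BalTensor R R Y ≃+ Y where
  __ := balLift ((Module.toAddMonoidEnd R Y).toAddMonoidHom : R →+ Y →+ Y)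
    fun x r y => mul_smul x r y
  invFun y := btmul R 1 y
  left_inv t := by
    induction t using balTensor_induction with
    | zero => simp
    | tmul x y =>
      change btmul R 1 (x • y) = _
      simp [← btmul_balanced]
    | add s t hs ht =>
      simp only [ZeroHom.toFun_eq_coe, AddMonoidHom.toZeroHom_coe] at hs ht ⊢
      rw [map_add, btmul_add, hs, ht]
  right_inv y := one_smul R y

@[simp] theorem ringBalTensor_btmul (r : R) (y : Y) : ringBalTensor (btmul R r y) = r • y := rfl

theorem ringBalTensor_bmap (g : Y →ₗ[R] Y') (t : BalTensor R R Y) :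
    ringBalTensor (bmap LinearMap.id g t) = g (ringBalTensor t) :=
  balTensor_congr ((ringBalTensor (R := R) (Y := Y')).toAddMonoidHom.comp (bmap LinearMap.id g))
    (g.toAddMonoidHom.comp (ringBalTensor (R := R) (Y := Y)).toAddMonoidHom) (fun x y => by simp) t

end Tensor

/-! ### Two out of three for exactness of complexes -/

section Chase

variable {A B C : ℤ → Type*} [∀ n, AddCommGroup (A n)] [∀ n, AddCommGroup (B n)]
  [∀ n, AddCommGroup (C n)] {a : ∀ n, A n →+ A (n + 1)} {b : ∀ n, B n →+ B (n + 1)}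
  {c : ∀ n, C n →+ C (n + 1)} {i : ∀ n, A n →+ B n} {p : ∀ n, B n →+ C n}

/-- The long exact homology sequence, chased by hand: a lift of a cycle of `C` is corrected by an
element of `A` until it is a cycle of `B`. -/
theorem exact_third (hi : ∀ n, Function.Injective (i n)) (hip : ∀ n, Function.Exact (i n) (p n))
    (hp : ∀ n, Function.Surjective (p n)) (hab : ∀ n x, i (n + 1) (a n x) = b n (i n x))
    (hbc : ∀ n x, p (n + 1) (b n x) = c n (p n x))
    (hA : ∀ n, Function.Exact (a n) (a (n + 1))) (hB : ∀ n, Function.Exact (b n) (b (n + 1)))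
    (n : ℤ) : Function.Exact (c n) (c (n + 1)) := by
  intro z
  obtain ⟨y, rfl⟩ := hp _ z
  constructor
  · intro h
    rw [← hbc] at h
    obtain ⟨x, hx⟩ := (hip _ _).1 h
    have hax : a _ x = 0 := hi _ (by rw [hab, hx, map_zero]; exact (hB _).apply_apply_eq_zero y)
    obtain ⟨x', rfl⟩ := (hA _ _).1 hax
    obtain ⟨y', hy'⟩ := (hB n (y - i _ x')).1 (by rw [map_sub, ← hab, hx, sub_self])
    refine ⟨p _ y', ?_⟩
    rw [← hbc, hy', map_sub, (hip _).apply_apply_eq_zero, sub_zero]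
  · rintro ⟨z', hz'⟩
    obtain ⟨y', rfl⟩ := hp _ z'
    rw [← hz', ← hbc, ← hbc, (hB _).apply_apply_eq_zero, map_zero]

theorem exact_first (hi : ∀ n, Function.Injective (i n)) (hip : ∀ n, Function.Exact (i n) (p n))
    (hp : ∀ n, Function.Surjective (p n)) (hab : ∀ n x, i (n + 1) (a n x) = b n (i n x))
    (hbc : ∀ n x, p (n + 1) (b n x) = c n (p n x))
    (hB : ∀ n, Function.Exact (b n) (b (n + 1))) (hC : ∀ n, Function.Exact (c n) (c (n + 1)))
    (n : ℤ) : Function.Exact (a n) (a (n + 1)) := by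
  -- The chase uses exactness of `C` one degree lower, at `C n`, which is `hC (n - 1)`; writing `n`
  -- as `m + 1` avoids casts between degrees.
  obtain ⟨m, rfl⟩ : ∃ m, n = m + 1 := ⟨n - 1, by omega⟩
  intro x
  constructor
  · intro h
    obtain ⟨y, hy⟩ := (hB _ (i _ x)).1 (by rw [← hab, h, map_zero])
    obtain ⟨z, hz⟩ := (hC _ (p _ y)).1 (by rw [← hbc, hy, (hip _).apply_apply_eq_zero])
    obtain ⟨y', rfl⟩ := hp _ z
    obtain ⟨x', hx'⟩ := (hip _ (y - b _ y')).1 (by rw [map_sub, hbc, hz, sub_self])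
    refine ⟨x', hi _ ?_⟩
    rw [hab, hx', map_sub, hy, (hB _).apply_apply_eq_zero, sub_zero]
  · rintro ⟨x', rfl⟩
    refine hi _ ?_
    rw [hab, hab, (hB _).apply_apply_eq_zero, map_zero]

end Chase

/-! ### Induction on the projective dimension -/

/-- Dimension shifting: the kernel of a projective presentation has a smaller bound on its
dimension, so it is enough to treat projectives and to pass from such a kernel to the quotient. -/
theorem finitePD_induction {R : Type u} [Ring R] {p : ModuleCat.{u} R → Prop}
    (proj : ∀ P : ModuleCat.{u} R, Module.Projective R P → p P)
    (step : ∀ S : ShortComplex (ModuleCat.{u} R), S.ShortExact → Module.Projective R S.X₂ →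
      p S.X₁ → p S.X₃) {X : ModuleCat.{u} R} (hX : FinitePD X) : p X := by
  obtain ⟨n, hn⟩ := hX
  induction n generalizing X with
  | zero =>
    exact proj X ((IsProjective.iff_projective X).2
      ((projective_iff_hasProjectiveDimensionLE_zero _).2 hn))
  | succ n ih =>
    let π := Projective.π X
    have hS := LinearMap.shortExact_shortComplexKer (f := π.hom)
      ((ModuleCat.epi_iff_surjective _).1 inferInstance)
    have hP : Projective (Projective.over X) := inferInstance
    refine step _ hS ((IsProjective.iff_projective _).2 hP) (ih ?_)
    exact (hS.hasProjectiveDimensionLT_X₃_iff _ hP).1 hn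

/-! ### Complexes of flat modules that stay exact under tensor products -/

section TensorExact

variable {R : Type u} [Ring R] {F : ℤ → ModuleCat.{u} R} (d : ∀ n : ℤ, F n →ₗ[R] F (n + 1))

/-- The complex `F` stays exact under `X ⊗_R -`. -/
def TensorExact (X : Type*) [AddCommGroup X] [Module Rᵐᵒᵖ X] : Prop :=
  ∀ n, Function.Exact (bmap (LinearMap.id : X →ₗ[Rᵐᵒᵖ] X) (d n))
    (bmap (LinearMap.id : X →ₗ[Rᵐᵒᵖ] X) (d (n + 1)))

variable {d}
variable {X X' X'' : Type u} [AddCommGroup X] [Module Rᵐᵒᵖ X] [AddCommGroup X'] [Module Rᵐᵒᵖ X']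
  [AddCommGroup X''] [Module Rᵐᵒᵖ X'']

/-- Flatness of the terms `F n` gives injectivity on the left; right exactness of the tensor product
gives the rest of the short exact sequence of complexes. -/
theorem TensorExact.third (hF : ∀ n, IsFlat R (F n)) {f : X →ₗ[Rᵐᵒᵖ] X'} {g : X' →ₗ[Rᵐᵒᵖ] X''}
    (hf : Function.Injective f) (hfg : Function.Exact f g) (hg : Function.Surjective g)
    (h : TensorExact d X) (h' : TensorExact d X') : TensorExact d X'' :=
  exact_third (i := fun n => bmap f (LinearMap.id : F n →ₗ[R] F n)) (fun n => hF n _ _ f hf)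
    (fun _ => bmap_exact_left hfg hg) (fun _ => bmap_surjective hg Function.surjective_id)
    (fun _ _ => bmap_comm _ _ _) (fun _ _ => bmap_comm _ _ _) h h'

theorem TensorExact.first (hF : ∀ n, IsFlat R (F n)) {f : X →ₗ[Rᵐᵒᵖ] X'} {g : X' →ₗ[Rᵐᵒᵖ] X''}
    (hf : Function.Injective f) (hfg : Function.Exact f g) (hg : Function.Surjective g)
    (h' : TensorExact d X') (h'' : TensorExact d X'') : TensorExact d X :=
  exact_first (i := fun n => bmap f (LinearMap.id : F n →ₗ[R] F n)) (fun n => hF n _ _ f hf)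
    (fun _ => bmap_exact_left hfg hg) (fun _ => bmap_surjective hg Function.surjective_id)
    (fun _ _ => bmap_comm _ _ _) (fun _ _ => bmap_comm _ _ _) h' h''

theorem TensorExact.retract (i : X →ₗ[Rᵐᵒᵖ] X') (r : X' →ₗ[Rᵐᵒᵖ] X)
    (hri : r ∘ₗ i = LinearMap.id) (h : TensorExact d X') : TensorExact d X := by
  intro n t
  have hr : ∀ {k} (t : BalTensor R X (F k)), bmap r LinearMap.id (bmap i LinearMap.id t) = t :=
    fun t => by rw [bmap_bmap, hri, LinearMap.comp_id, bmap_id]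
  constructor
  · intro ht
    obtain ⟨s, hs⟩ := (h n (bmap i LinearMap.id t)).1 (by rw [← bmap_comm, ht, map_zero])
    exact ⟨bmap r LinearMap.id s, by rw [← bmap_comm, hs, hr]⟩
  · rintro ⟨s, rfl⟩
    rw [← hr (bmap _ _ (bmap _ _ _)), bmap_comm i, bmap_comm i, (h n).apply_apply_eq_zero, map_zero]

theorem TensorExact.self (hd : ∀ n, Function.Exact (d n) (d (n + 1))) : TensorExact d R := by
  intro n t
  constructor
  · intro ht
    obtain ⟨y, hy⟩ := (hd n (ringBalTensor t)).1 (by rw [← ringBalTensor_bmap, ht, map_zero])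
    exact ⟨ringBalTensor.symm y, ringBalTensor.injective (by simp [ringBalTensor_bmap, hy])⟩
  · rintro ⟨s, rfl⟩
    refine ringBalTensor.injective ?_
    rw [ringBalTensor_bmap, ringBalTensor_bmap, (hd n).apply_apply_eq_zero, map_zero]

/-- Tensors over a projective right module are recovered from their coordinates in a
dual basis. -/
theorem TensorExact.of_projective [Module.Projective Rᵐᵒᵖ X]
    (hd : ∀ n, Function.Exact (d n) (d (n + 1))) : TensorExact d X := by
  classical
  obtain ⟨σ, hσ⟩ := Module.projective_def'.1 (inferInstance : Module.Projective Rᵐᵒᵖ X)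
  let ι (q : X) : R →ₗ[Rᵐᵒᵖ] X :=
    { toFun r := MulOpposite.op r • q
      map_add' r r' := by simp [add_smul]
      map_smul' r r' := by simp [mul_smul] }
  let π (q : X) : X →ₗ[Rᵐᵒᵖ] R :=
    { toFun x := (σ x q).unop
      map_add' x x' := by simp
      map_smul' r x := by simp }
  -- Allowing every finite set containing `s` lets the additive case use the union of two index
  -- sets.
  have key {Y : Type u} [AddCommGroup Y] [Module R Y] (t : BalTensor R X Y) : ∃ s : Finset X,
      ∀ s', s ⊆ s' → ∑ q ∈ s', bmap (ι q) LinearMap.id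
        (bmap (π q) (LinearMap.id : Y →ₗ[R] Y) t) = t := by
    induction t using balTensor_induction with
    | zero => exact ⟨∅, fun s' _ => by simp⟩
    | tmul x y =>
      refine ⟨(σ x).support, fun s' hs => ?_⟩
      have hx : ∑ q ∈ s', σ x q • q = x := by
        rw [← Finset.sum_subset hs fun q _ hq => by simp [Finsupp.notMem_support_iff.1 hq]]
        exact LinearMap.congr_fun hσ x
      let τ : X →+ BalTensor R X Y := AddMonoidHom.mk' (fun x => btmul R x y)
        fun x x' => add_btmul x x' y
      change ∑ q ∈ s', τ (σ x q • q) = τ x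
      rw [← map_sum, hx]
    | add t t' ht ht' =>
      obtain ⟨s, hs⟩ := ht
      obtain ⟨s', hs'⟩ := ht'
      refine ⟨s ∪ s', fun s'' h => ?_⟩
      simp only [map_add, Finset.sum_add_distrib]
      rw [hs _ (Finset.subset_union_left.trans h), hs' _ (Finset.subset_union_right.trans h)]
  intro n t
  constructor
  · intro ht
    obtain ⟨s, hs⟩ := key t
    -- Each coordinate of `t` is a cycle of `R ⊗ F`, which is exact; the chosen preimages are
    -- recombined through the maps `ι q`.
    have h q : ∃ y, bmap LinearMap.id (d n) y = bmap (π q) LinearMap.id t :=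
      (TensorExact.self hd n _).1 (by rw [← bmap_comm, ht, map_zero])
    choose y hy using h
    refine ⟨∑ q ∈ s, bmap (ι q) LinearMap.id (y q), ?_⟩
    simp_rw [map_sum, ← bmap_comm, hy]
    exact hs s subset_rfl
  · rintro ⟨t, rfl⟩
    rw [bmap_bmap, (hd n).linearMap_comp_eq_zero]
    exact balTensor_congr _ 0 (fun x y => by simp) t

theorem TensorExact.of_finitePD (hF : ∀ n, IsFlat R (F n))
    (hd : ∀ n, Function.Exact (d n) (d (n + 1))) {X : ModuleCat.{u} Rᵐᵒᵖ} (hX : FinitePD X) :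
    TensorExact d X := by
  refine finitePD_induction (p := fun X => TensorExact d X) (fun P _ => .of_projective hd)
    (fun S hS hP h => ?_) hX
  exact .third hF hS.moduleCat_injective_f
    ((ShortComplex.ShortExact.moduleCat_exact_iff_function_exact _).1 hS.exact)
    hS.moduleCat_surjective_g h (.of_projective hd)

/-- If `F` is exact and stays exact under `X ⊗_R -`, then so does the inclusion of its cycles. -/
theorem TensorExact.cycles (hd : ∀ n, Function.Exact (d n) (d (n + 1))) (h : TensorExact d X)
    (n : ℤ) : Function.Injective (bmap (LinearMap.id : X →ₗ[Rᵐᵒᵖ] X) (LinearMap.ker (d n)).subtype) ∧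
      Function.Exact (bmap (LinearMap.id : X →ₗ[Rᵐᵒᵖ] X) (LinearMap.ker (d n)).subtype)
        (bmap (LinearMap.id : X →ₗ[Rᵐᵒᵖ] X) (d n)) := by
  -- By exactness the cycles in degree `m + 2` are the cokernel of `d m`, and right exactness then
  -- describes their tensor product with `X`.
  obtain ⟨m, rfl⟩ : ∃ m, n = m + 1 + 1 := ⟨n - 2, by omega⟩
  let q : F (m + 1) →ₗ[R] LinearMap.ker (d (m + 1 + 1)) :=
    (d (m + 1)).codRestrict _ (hd _).apply_apply_eq_zero
  have hq : Function.Surjective q := fun x => by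
    obtain ⟨y, hy⟩ := (hd _ _).1 x.2
    exact ⟨y, Subtype.ext hy⟩
  have hq' : Function.Exact (d m) q := fun x => by
    rw [← hd m x, ← Subtype.coe_inj]
    rfl
  have hjq (t : BalTensor R X (F (m + 1))) : bmap (LinearMap.id : X →ₗ[Rᵐᵒᵖ] X)
      (LinearMap.ker (d (m + 1 + 1))).subtype (bmap LinearMap.id q t) =
        bmap LinearMap.id (d (m + 1)) t := by
    rw [bmap_bmap]
    rfl
  have hs := bmap_surjective (f := (LinearMap.id : X →ₗ[Rᵐᵒᵖ] X)) Function.surjective_id hq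
  constructor
  · refine (injective_iff_map_eq_zero _).2 fun t ht => ?_
    obtain ⟨t, rfl⟩ := hs t
    rw [hjq] at ht
    obtain ⟨s, rfl⟩ := (h m _).1 ht
    exact (bmap_exact_right hq' hq).apply_apply_eq_zero s
  · intro t
    rw [h (m + 1) t]
    constructor
    · rintro ⟨s, rfl⟩
      exact ⟨_, hjq s⟩
    · rintro ⟨s, rfl⟩
      obtain ⟨s, rfl⟩ := hs s
      exact ⟨s, (hjq s).symm⟩

end TensorExact

/-! ### Finite projective dimension in short exact sequences -/

section FinitePD

variable {R : Type u} [Ring R] {X X' X'' : Type u} [AddCommGroup X] [Module R X]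
  [AddCommGroup X'] [Module R X'] [AddCommGroup X''] [Module R X'']

theorem FinitePD.of_projective [Module.Projective R X] : FinitePD (ModuleCat.of R X) :=
  ⟨0, (projective_iff_hasProjectiveDimensionLE_zero _).1
    ((IsProjective.iff_projective X).1 inferInstance)⟩

theorem shortExact_of_linearMap {f : X →ₗ[R] X'} {g : X' →ₗ[R] X''} (hf : Function.Injective f)
    (hfg : Function.Exact f g) (hg : Function.Surjective g) :
    (ShortComplex.mk (ModuleCat.ofHom f) (ModuleCat.ofHom g) (by
      ext x
      exact hfg.apply_apply_eq_zero x)).ShortExact :=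
  ModuleCat.shortComplex_shortExact _ hfg hf hg

theorem FinitePD.middle {f : X →ₗ[R] X'} {g : X' →ₗ[R] X''} (hf : Function.Injective f)
    (hfg : Function.Exact f g) (hg : Function.Surjective g) (h : FinitePD (ModuleCat.of R X))
    (h'' : FinitePD (ModuleCat.of R X'')) : FinitePD (ModuleCat.of R X') := by
  obtain ⟨n, hn⟩ := h
  obtain ⟨m, hm⟩ := h''
  exact ⟨max n m, (shortExact_of_linearMap hf hfg hg).hasProjectiveDimensionLT_X₂ _
    (hasProjectiveDimensionLT_of_ge _ (n + 1) _ (by omega))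
    (hasProjectiveDimensionLT_of_ge _ (m + 1) _ (by omega))⟩

theorem FinitePD.third {f : X →ₗ[R] X'} {g : X' →ₗ[R] X''} (hf : Function.Injective f)
    (hfg : Function.Exact f g) (hg : Function.Surjective g) (h : FinitePD (ModuleCat.of R X))
    (h' : FinitePD (ModuleCat.of R X')) : FinitePD (ModuleCat.of R X'') := by
  obtain ⟨n, hn⟩ := h
  obtain ⟨m, hm⟩ := h'
  exact ⟨max n m + 1, (shortExact_of_linearMap hf hfg hg).hasProjectiveDimensionLT_X₃ _
    (hasProjectiveDimensionLT_of_ge _ (n + 1) _ (by omega))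
    (hasProjectiveDimensionLT_of_ge _ (m + 1) _ (by omega))⟩

theorem FinitePD.prod (h : FinitePD (ModuleCat.of R X)) (h' : FinitePD (ModuleCat.of R X')) :
    FinitePD (ModuleCat.of R (X × X')) :=
  .middle (f := LinearMap.inl R X X') (g := LinearMap.snd R X X') LinearMap.inl_injective
    .inl_snd LinearMap.snd_surjective h h'

end FinitePD

/-! ### Restriction of scalars -/

section Restr

variable {T S : Type u} [Ring T] [Ring S] (ρ : T →+* S)

/-- The left or right `S`-module `X`, viewed as a `T`-module through `ρ : T → S`. -/
@[nolint unusedArguments]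
def Restr (_ρ : T →+* S) (X : Type u) : Type u := X

variable (X : Type u) [AddCommGroup X]

instance : AddCommGroup (Restr ρ X) := inferInstanceAs (AddCommGroup X)

instance [Module S X] : Module T (Restr ρ X) := Module.compHom X ρ

instance [Module Sᵐᵒᵖ X] : Module Tᵐᵒᵖ (Restr ρ X) := Module.compHom X ρ.op

variable {X}

variable (X) in
/-- The identity map from `X` to its restriction of scalars. -/
def toRestr : X ≃+ Restr ρ X := AddEquiv.refl X

theorem op_smul_toRestr [Module Sᵐᵒᵖ X] (t : T) (x : X) :
    MulOpposite.op t • toRestr ρ X x = toRestr ρ X (MulOpposite.op (ρ t) • x) := rfl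

/-- Together with the right action of `T` through `ρ`, this makes `Restr ρ S` a bimodule, so that `S
⊗_T Y` becomes a left `S`-module by `balTensorModule`. -/
instance : Module S (Restr ρ S) := inferInstanceAs (Module S S)

instance : SMulCommClass S Tᵐᵒᵖ (Restr ρ S) :=
  ⟨fun s t x => smul_comm (M := S) (N := Sᵐᵒᵖ) (α := S) s (ρ.op t) x⟩

theorem leftMul_toRestr (s s' : S) :
    leftMul (R := T) s (toRestr ρ S s') = toRestr ρ S (s * s') := rfl

/-- An `S`-linear map, viewed as a `T`-linear map. -/
def restrMap {Y : Type u} [AddCommGroup Y] [Module S X] [Module S Y] (f : X →ₗ[S] Y) :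
    Restr ρ X →ₗ[T] Restr ρ Y where
  toFun := f
  map_add' := map_add f
  map_smul' t x := f.map_smul (ρ t) x

/-- A homomorphism of right `S`-modules, viewed as a homomorphism of right `T`-modules. -/
def restrMapOp {Y : Type u} [AddCommGroup Y] [Module Sᵐᵒᵖ X] [Module Sᵐᵒᵖ Y] (f : X →ₗ[Sᵐᵒᵖ] Y) :
    Restr ρ X →ₗ[Tᵐᵒᵖ] Restr ρ Y where
  toFun := f
  map_add' := map_add f
  map_smul' t x := f.map_smul (ρ.op t) x

/-- If `S` is projective over `T`, then so is every projective `S`-module. -/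
theorem projective_restr (h : Module.Projective T (Restr ρ S)) [Module S X]
    [Module.Projective S X] : Module.Projective T (Restr ρ X) := by
  obtain ⟨σ, hσ⟩ := Module.projective_def'.1 (inferInstance : Module.Projective S X)
  -- `X` is a retract of the free module `X →₀ S`, whose restriction is a direct sum of copies of
  -- the projective `T`-module `S`. The maps `e` and `e'` are identities on elements.
  let e : Restr ρ (X →₀ S) →ₗ[T] (X →₀ Restr ρ S) :=
    { toFun := fun f => (show X →₀ S from f)
      map_add' := fun _ _ => rfl
      map_smul' := fun _ _ => rfl }
  let e' : (X →₀ Restr ρ S) →ₗ[T] Restr ρ (X →₀ S) :=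
    { toFun := fun f => (show X →₀ S from f)
      map_add' := fun _ _ => rfl
      map_smul' := fun _ _ => rfl }
  classical
  have : Module.Projective T (X →₀ Restr ρ S) :=
    .of_equiv' (finsuppLEquivDirectSum T (Restr ρ S) X).symm
  exact .of_split (e ∘ₗ restrMap ρ σ) (restrMap ρ (Finsupp.linearCombination S id) ∘ₗ e')
    (LinearMap.ext fun x => LinearMap.congr_fun hσ x)

theorem FinitePD.restr (h : Module.Projective T (Restr ρ S)) [Module S X]
    (hX : FinitePD (ModuleCat.of S X)) : FinitePD (ModuleCat.of T (Restr ρ X)) := by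
  refine finitePD_induction (p := fun X => FinitePD (ModuleCat.of T (Restr ρ X)))
    (fun P hP => ?_) (fun E hE hP h₁ => ?_) hX
  · have := projective_restr ρ h (X := P)
    exact .of_projective
  · have := projective_restr ρ h (X := E.X₂)
    exact FinitePD.third (f := restrMap ρ E.f.hom) (g := restrMap ρ E.g.hom) hE.moduleCat_injective_f
      ((ShortComplex.ShortExact.moduleCat_exact_iff_function_exact _).1 hE.exact)
      hE.moduleCat_surjective_g h₁ FinitePD.of_projective

/-- The homomorphism of right `T`-modules `S → X`, `s ↦ x s`. -/
def restrAct [Module Sᵐᵒᵖ X] (x : X) : Restr ρ S →ₗ[Tᵐᵒᵖ] Restr ρ X where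
  toFun s := toRestr ρ X (MulOpposite.op ((toRestr ρ S).symm s) • x)
  map_add' s s' := by rw [map_add, MulOpposite.op_add, add_smul, map_add]
  map_smul' t s := congrArg (toRestr ρ X)
    (mul_smul (ρ.op t) (MulOpposite.op ((toRestr ρ S).symm s)) x)

theorem restrAct_toRestr [Module Sᵐᵒᵖ X] (x : X) (s : S) :
    restrAct ρ x (toRestr ρ S s) = toRestr ρ X (MulOpposite.op s • x) := rfl

variable (X) in
/-- The isomorphism `X ⊗_S (S ⊗_T Y) ≅ X ⊗_T Y`. -/
def balTensorRestr [Module Sᵐᵒᵖ X] (Y : Type u) [AddCommGroup Y] [Module T Y] :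
    BalTensor S X (BalTensor T (Restr ρ S) Y) ≃+ BalTensor T (Restr ρ X) Y :=
  let f : BalTensor S X (BalTensor T (Restr ρ S) Y) →+ BalTensor T (Restr ρ X) Y := balLift
    (AddMonoidHom.mk' (fun x => bmap (restrAct ρ x) LinearMap.id) fun x x' =>
      balTensor_hom_ext fun s y => by
        obtain ⟨s, rfl⟩ := (toRestr ρ S).surjective s
        simp only [AddMonoidHom.add_apply, bmap_btmul, ← add_btmul, restrAct_toRestr, smul_add,
          map_add])
    fun x r z => balTensor_congr (bmap (restrAct ρ (MulOpposite.op r • x)) LinearMap.id)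
      ((bmap (restrAct ρ x) LinearMap.id).comp (bmap (leftMul r) LinearMap.id))
      (fun s y => by
        obtain ⟨s, rfl⟩ := (toRestr ρ S).surjective s
        simp only [AddMonoidHom.comp_apply, bmap_btmul, restrAct_toRestr, leftMul_toRestr,
          MulOpposite.op_mul, mul_smul, LinearMap.id_apply]) z
  let g : BalTensor T (Restr ρ X) Y →+ BalTensor S X (BalTensor T (Restr ρ S) Y) := balLift
    (AddMonoidHom.mk' (fun x => AddMonoidHom.mk'
      (fun y => btmul S ((toRestr ρ X).symm x) (btmul T (toRestr ρ S 1) y))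
        fun y y' => by simp only [btmul_add])
      fun x x' => AddMonoidHom.ext fun y => by
        simp only [map_add, add_btmul, AddMonoidHom.mk'_apply, AddMonoidHom.add_apply])
    fun x t y => by
      obtain ⟨x, rfl⟩ := (toRestr ρ X).surjective x
      simp only [AddMonoidHom.mk'_apply, op_smul_toRestr, AddEquiv.symm_apply_apply]
      rw [btmul_balanced, ← btmul_balanced (toRestr ρ S 1), op_smul_toRestr, smul_btmul]
      refine congrArg (fun s : S => btmul S x (btmul T (toRestr ρ S s) y)) ?_
      exact (mul_one (ρ t)).trans (one_mul (ρ t)).symm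
  { f with
    invFun := g
    left_inv := by
      refine balTensor_congr (g.comp f) (AddMonoidHom.id _) (fun x z => ?_)
      refine balTensor_congr ((g.comp f).comp (AddMonoidHom.mk' (fun z => btmul S x z)
        fun z z' => btmul_add x z z')) (AddMonoidHom.mk' (fun z => btmul S x z)
        fun z z' => btmul_add x z z') (fun s y => ?_) z
      obtain ⟨s, rfl⟩ := (toRestr ρ S).surjective s
      change btmul S (MulOpposite.op s • x) (btmul T (toRestr ρ S 1) y) = btmul S x _
      rw [btmul_balanced]
      exact congrArg (fun z : S => btmul S x (btmul T (toRestr ρ S z) y)) (mul_one s)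
    right_inv := by
      refine balTensor_congr (f.comp g) (AddMonoidHom.id _) (fun x y => ?_)
      obtain ⟨x, rfl⟩ := (toRestr ρ X).surjective x
      exact congrArg (fun z : X => btmul T (toRestr ρ X z) y) (one_smul Sᵐᵒᵖ x) }

/-- The homomorphism of left `S`-modules `S ⊗_T Y → S ⊗_T Y'` induced by `g : Y → Y'`. -/
def extendMap {Y Y' : Type u} [AddCommGroup Y] [Module T Y] [AddCommGroup Y'] [Module T Y']
    (g : Y →ₗ[T] Y') : BalTensor T (Restr ρ S) Y →ₗ[S] BalTensor T (Restr ρ S) Y' where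
  toFun := bmap LinearMap.id g
  map_add' := map_add _
  map_smul' s t := (bmap_comm (leftMul s) g t).symm

theorem balTensorRestr_bmap [Module Sᵐᵒᵖ X] {X' : Type u} [AddCommGroup X'] [Module Sᵐᵒᵖ X']
    {Y Y' : Type u} [AddCommGroup Y] [Module T Y] [AddCommGroup Y'] [Module T Y']
    (f : X →ₗ[Sᵐᵒᵖ] X') (g : Y →ₗ[T] Y') (t : BalTensor S X (BalTensor T (Restr ρ S) Y)) :
    balTensorRestr ρ X' Y' (bmap f (extendMap ρ g) t) =
      bmap (restrMapOp ρ f) g (balTensorRestr ρ X Y t) := by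
  induction t using balTensor_induction with
  | zero => simp only [map_zero]
  | add s t hs ht => simp only [map_add, hs, ht]
  | tmul x z =>
    induction z using balTensor_induction with
    | zero => simp only [map_zero, btmul_zero]
    | add s t hs ht => simp only [map_add, btmul_add, hs, ht]
    | tmul s y =>
      obtain ⟨s, rfl⟩ := (toRestr ρ S).surjective s
      exact congrArg (fun z : X' => btmul T (toRestr ρ X' z) (g y))
        (map_smul f (MulOpposite.op s) x).symm

/-- The isomorphism `X ⊗_S (S ⊗_T Y) ≅ X ⊗_T Y` is natural in `X`, and restriction of scalars keeps
injections injective. -/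
theorem IsFlat.extend {Y : Type u} [AddCommGroup Y] [Module T Y] (hY : IsFlat T Y) :
    IsFlat S (BalTensor T (Restr ρ S) Y) := by
  intro X X' _ _ _ _ f hf
  have h := hY _ _ (restrMapOp ρ f) hf
  have key t : balTensorRestr ρ X' Y (bmap f LinearMap.id t) =
      bmap (restrMapOp ρ f) LinearMap.id (balTensorRestr ρ X Y t) := by
    rw [← balTensorRestr_bmap]
    congr 3
    exact LinearMap.ext fun t => (bmap_id t).symm
  exact fun s t hst => (balTensorRestr ρ X Y).injective (h (by rw [← key, ← key, hst]))

theorem TensorExact.extend {F : ℤ → ModuleCat.{u} T} {d : ∀ n : ℤ, F n →ₗ[T] F (n + 1)}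
    [Module Sᵐᵒᵖ X] (h : TensorExact d (Restr ρ X)) :
    TensorExact (R := S) (F := fun n => ModuleCat.of S (BalTensor T (Restr ρ S) (F n)))
      (fun n => extendMap ρ (d n)) X := by
  intro n
  have key n (t) : balTensorRestr ρ X _ (bmap LinearMap.id (extendMap ρ (d n)) t) =
      bmap (LinearMap.id : Restr ρ X →ₗ[Tᵐᵒᵖ] Restr ρ X) (d n) (balTensorRestr ρ X _ t) :=
    balTensorRestr_bmap ρ LinearMap.id (d n) t
  intro t
  refine (balTensorRestr ρ X _).map_eq_zero_iff.symm.trans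
    ((Eq.congr_left (key (n + 1) t)).trans ((h n _).trans ?_))
  constructor
  · rintro ⟨s, hs⟩
    obtain ⟨s, rfl⟩ := (balTensorRestr ρ X _).surjective s
    exact ⟨s, (balTensorRestr ρ X _).injective ((key n s).trans hs)⟩
  · rintro ⟨s, rfl⟩
    exact ⟨_, (key n s).symm⟩

end Restr

/-! ### Dual modules -/

section Dual

/-- The group of additive homomorphisms `N → D`; a right module over `R` if `N` is a left
`R`-module. -/
def Dual (N D : Type u) [AddCommGroup N] [AddCommGroup D] : Type u := N →+ D

variable {R : Type u} [Ring R] {N : Type u} [AddCommGroup N] [Module R N]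
variable {D : Type u} [AddCommGroup D]

instance : AddCommGroup (Dual N D) := inferInstanceAs (AddCommGroup (N →+ D))

instance : FunLike (Dual N D) N D := inferInstanceAs (FunLike (N →+ D) N D)

instance : AddMonoidHomClass (Dual N D) N D := inferInstanceAs (AddMonoidHomClass (N →+ D) N D)

instance : Module Rᵐᵒᵖ (Dual N D) where
  smul r f := AddMonoidHom.comp (show N →+ D from f) (Module.toAddMonoidEnd R N r.unop)
  one_smul f := AddMonoidHom.ext fun x => congrArg f (one_smul R x)
  mul_smul r s f := AddMonoidHom.ext fun x => congrArg f (mul_smul s.unop r.unop x)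
  smul_zero _ := rfl
  smul_add _ _ _ := rfl
  add_smul r s f := AddMonoidHom.ext fun x =>
    (congrArg f (add_smul r.unop s.unop x)).trans (map_add f _ _)
  zero_smul f := AddMonoidHom.ext fun x => (congrArg f (zero_smul R x)).trans (map_zero f)

@[simp] theorem dual_smul_apply (r : Rᵐᵒᵖ) (f : Dual N D) (x : N) : (r • f) x = f (r.unop • x) :=
  rfl

@[simp] theorem dual_add_apply (f g : Dual N D) (x : N) : (f + g) x = f x + g x := rfl

/-- The homomorphism of right modules `N'* → N*` dual to `f : N → N'`. -/
def dualMap {N' : Type u} [AddCommGroup N'] [Module R N'] (f : N →ₗ[R] N') :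
    Dual N' D →ₗ[Rᵐᵒᵖ] Dual N D where
  toFun g := AddMonoidHom.comp (show N' →+ D from g) f.toAddMonoidHom
  map_add' _ _ := rfl
  map_smul' r g := AddMonoidHom.ext fun x => congrArg g (map_smul f r.unop x).symm

theorem exists_extension [Module.Injective ℤ D] {X Y : Type u} [AddCommGroup X] [AddCommGroup Y]
    {f : X →+ Y} (hf : Function.Injective f) (g : X →+ D) : ∃ h : Y →+ D, ∀ x, h (f x) = g x := by
  obtain ⟨h, hh⟩ := Module.Injective.out (R := ℤ) (Q := D) f.toIntLinearMap hf g.toIntLinearMap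
  exact ⟨h.toAddMonoidHom, hh⟩

variable (D) in
theorem dualMap_exact [Module.Injective ℤ D] {N' N'' : Type u} [AddCommGroup N'] [Module R N']
    [AddCommGroup N''] [Module R N''] {f : N →ₗ[R] N'} {g : N' →ₗ[R] N''}
    (hf : Function.Injective f) (hfg : Function.Exact f g) (hg : Function.Surjective g) :
    Function.Injective (dualMap g : Dual N'' D →ₗ[Rᵐᵒᵖ] Dual N' D) ∧
      Function.Exact (dualMap g : Dual N'' D →ₗ[Rᵐᵒᵖ] Dual N' D) (dualMap f) ∧
        Function.Surjective (dualMap f : Dual N' D →ₗ[Rᵐᵒᵖ] Dual N D) := by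
  refine ⟨fun p q h => ?_, fun p => ⟨fun h => ?_, ?_⟩, fun p => ?_⟩
  · refine DFunLike.ext _ _ fun x => ?_
    obtain ⟨y, rfl⟩ := hg x
    exact DFunLike.congr_fun h y
  · have hp : ∀ y, g y = 0 → p y = 0 := fun y hy => by
      obtain ⟨x, rfl⟩ := (hfg y).1 hy
      exact DFunLike.congr_fun h x
    exact ⟨AddMonoidHom.liftOfSurjective g.toAddMonoidHom hg ⟨(show N' →+ D from p), hp⟩,
      AddMonoidHom.ext fun y => AddMonoidHom.liftOfRightInverse_comp_apply _ _
        (Function.rightInverse_surjInv hg) _ y⟩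
  · rintro ⟨q, rfl⟩
    exact AddMonoidHom.ext fun x =>
      (congrArg q (hfg.apply_apply_eq_zero x)).trans (map_zero q)
  · obtain ⟨q, hq⟩ := exists_extension (f := f.toAddMonoidHom) hf (show N →+ D from p)
    exact ⟨q, AddMonoidHom.ext hq⟩

variable (N D) in
/-- The dual of a projective left module is an injective right module. -/
theorem injective_dual [Module.Injective ℤ D] [Module.Projective R N] :
    Module.Injective Rᵐᵒᵖ (Dual N D) := by
  obtain ⟨σ, hσ⟩ := Module.projective_def'.1 (inferInstance : Module.Projective R N)
  refine ⟨fun X Y _ _ _ _ f hf g => ?_⟩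
  -- Writing `n = ∑ σ(n)_q q` reduces the extension of `g` to that of the additive maps `x ↦ g x q`,
  -- one for each `q`; then `G y n = ∑ h q (y σ(n)_q)`.
  have ext q : ∃ h : Y →+ D, ∀ x, h (f x) = g x q :=
    exists_extension (f := f.toAddMonoidHom) hf
      (AddMonoidHom.mk' (fun x => g x q) fun x x' => by simp)
  choose h hh using ext
  let G (y : Y) : N →+ D := (Finsupp.liftAddHom fun q : N => (h q).comp
    ((AddMonoidHom.mk' (fun r : R => MulOpposite.op r • y) fun r r' => by simp [add_smul]))).comp
      σ.toAddMonoidHom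
  have hG y n : G y n = (σ n).sum fun q r => h q (MulOpposite.op r • y) := rfl
  refine ⟨{ toFun := G, map_add' := fun y y' => ?_, map_smul' := fun r y => ?_ }, fun x => ?_⟩
  · refine AddMonoidHom.ext fun n => ?_
    change G (y + y') n = G y n + G y' n
    simp only [hG, smul_add, map_add]
    exact Finsupp.sum_add
  · refine AddMonoidHom.ext fun n => ?_
    change G (r • y) n = G y (r.unop • n)
    rw [hG, hG, map_smul, Finsupp.sum_smul_index fun q => by simp]
    simp [mul_smul]
  · refine AddMonoidHom.ext fun n => ?_
    change G (f x) n = g x n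
    rw [hG]
    simp only [← map_smul, hh]
    simp only [map_smul, dual_smul_apply, MulOpposite.unop_op]
    rw [← map_finsuppSum]
    exact congrArg (g x) (LinearMap.congr_fun hσ n)

/-- Duality reverses the short exact sequences of the induction: the middle term becomes injective,
and exactness passes to the kernel instead of the quotient. -/
theorem TensorExact.dual [Module.Injective ℤ D] {F : ℤ → ModuleCat.{u} R}
    {d : ∀ n : ℤ, F n →ₗ[R] F (n + 1)} (hF : ∀ n, IsFlat R (F n))
    (hI : ∀ (I : Type u) [AddCommGroup I] [Module Rᵐᵒᵖ I], Module.Injective Rᵐᵒᵖ I →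
      TensorExact d I) (hN : FinitePD (ModuleCat.of R N)) : TensorExact d (Dual N D) := by
  refine finitePD_induction (p := fun N => TensorExact d (Dual N D))
    (fun P _ => hI _ (injective_dual P D)) (fun E hE hP h => ?_) hN
  obtain ⟨h₁, h₂, h₃⟩ := dualMap_exact D hE.moduleCat_injective_f
    ((ShortComplex.ShortExact.moduleCat_exact_iff_function_exact _).1 hE.exact)
    hE.moduleCat_surjective_g
  exact .first hF h₁ h₂ h₃ (hI _ (injective_dual E.X₂ D)) h

/-- An injective right module is a retract of the dual of the ring in an injective group. -/
theorem exists_retract_dual (I : Type u) [AddCommGroup I] [Module Rᵐᵒᵖ I]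
    (hI : Module.Injective Rᵐᵒᵖ I) :
    ∃ (D : Type u) (_ : AddCommGroup D), Module.Injective ℤ D ∧
      ∃ (i : I →ₗ[Rᵐᵒᵖ] Dual R D) (r : Dual R D →ₗ[Rᵐᵒᵖ] I), r ∘ₗ i = LinearMap.id := by
  let D := Injective.under (ModuleCat.of ℤ I)
  let j : I →ₗ[ℤ] D := (Injective.ι (ModuleCat.of ℤ I)).hom
  have hj : Function.Injective j := (ModuleCat.mono_iff_injective _).1 inferInstance
  have hD : Module.Injective ℤ D := 
    (Module.injective_iff_injective_object ℤ D).2 (inferInstanceAs (Injective (Injective.under _)))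
  -- The map `x ↦ (r ↦ j (x r))` is injective by evaluation at `1`, and it splits because `I` is
  -- injective.
  let i : I →ₗ[Rᵐᵒᵖ] Dual R D :=
    { toFun := fun x => AddMonoidHom.mk' (fun r : R => j (MulOpposite.op r • x))
        fun r r' => by simp [add_smul]
      map_add' := fun x y => AddMonoidHom.ext fun r => by
        change j (MulOpposite.op r • (x + y)) = j (MulOpposite.op r • x) + j (MulOpposite.op r • y)
        simp
      map_smul' := fun s x => AddMonoidHom.ext fun r => by
        change j (MulOpposite.op r • s • x) = j (MulOpposite.op (s.unop * r) • x)
        simp [mul_smul] }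
  have hi : Function.Injective i := fun x y h => hj (by
    have := DFunLike.congr_fun h (1 : R)
    change j (MulOpposite.op 1 • x) = j (MulOpposite.op 1 • y) at this
    simpa using this)
  obtain ⟨r, hr⟩ := hI.out i hi LinearMap.id
  exact ⟨D, inferInstance, by convert hD; exact Subsingleton.elim _ _, i, r, LinearMap.ext hr⟩

end Dual

/-! ### Extension of scalars of Gorenstein flat modules -/

theorem IsGorensteinFlat.of_equiv {R : Type u} [Ring R] {M N : Type u} [AddCommGroup M]
    [Module R M] [AddCommGroup N] [Module R N] (e : M ≃ₗ[R] N) (h : IsGorensteinFlat R M) :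
    IsGorensteinFlat R N := by
  obtain ⟨F, d, hF, hd, ⟨f⟩, hI⟩ := h
  exact ⟨F, d, hF, hd, ⟨e.symm.trans f⟩, hI⟩

/-- If `S` has finite projective dimension as a left and as a right `T`-module, then `S ⊗_T -`
preserves Gorenstein flat modules. -/
theorem IsGorensteinFlat.extend {T S : Type u} [Ring T] [Ring S] (ρ : T →+* S)
    (hl : FinitePD (ModuleCat.of T (Restr ρ S))) (hr : FinitePD (ModuleCat.of Tᵐᵒᵖ (Restr ρ S)))
    {M : Type u} [AddCommGroup M] [Module T M] (hM : IsGorensteinFlat T M) :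
    IsGorensteinFlat S (BalTensor T (Restr ρ S) M) := by
  obtain ⟨F, d, hF, hd, ⟨f⟩, hI⟩ := hM
  have hS : TensorExact d (Restr ρ S) := .of_finitePD hF hd hr
  refine ⟨fun n => ModuleCat.of S (BalTensor T (Restr ρ S) (F n)), fun n => extendMap ρ (d n),
    fun n => (hF n).extend ρ, hS, ?_, fun I _ _ hI' => ?_⟩
  -- Forming cycles commutes with `S ⊗_T -` here, so `S ⊗_T M` is the kernel of the extended
  -- differential.
  · obtain ⟨h₁, h₂⟩ := hS.cycles hd 0
    have hf t : bmap (LinearMap.id : Restr ρ S →ₗ[Tᵐᵒᵖ] Restr ρ S)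
        (LinearMap.ker (d 0)).subtype (bmap LinearMap.id f.toLinearMap t) =
          extendMap ρ ((LinearMap.ker (d 0)).subtype ∘ₗ f.toLinearMap) t :=
      bmap_bmap _ _ _ _ t
    have hinj : Function.Injective
        (bmap (LinearMap.id : Restr ρ S →ₗ[Tᵐᵒᵖ] Restr ρ S) f.toLinearMap) := by
      refine Function.LeftInverse.injective (g := bmap LinearMap.id f.symm.toLinearMap) fun t => ?_
      rw [bmap_bmap, LinearEquiv.symm_comp, LinearMap.id_comp, bmap_id]
    refine ⟨(LinearEquiv.ofInjective
      (extendMap ρ ((LinearMap.ker (d 0)).subtype ∘ₗ f.toLinearMap)) fun s t h => ?_).trans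
        (LinearEquiv.ofEq _ _ ?_)⟩
    · rw [← hf, ← hf] at h
      exact hinj (h₁ h)
    · ext t
      refine Iff.trans ?_ (h₂ t).symm
      constructor
      · rintro ⟨s, rfl⟩
        exact ⟨_, hf s⟩
      · rintro ⟨s, rfl⟩
        obtain ⟨s, rfl⟩ := bmap_surjective (f := (LinearMap.id : Restr ρ S →ₗ[Tᵐᵒᵖ] Restr ρ S))
          Function.surjective_id f.surjective s
        exact ⟨s, (hf s).symm⟩
  -- Restricting the retraction to `T` makes `I` a retract of the dual of the left `T`-module `S`,
  -- which is where `hl` enters.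
  · obtain ⟨D, _, hD, i, r, hri⟩ := exists_retract_dual I hI'
    have hN : TensorExact d (Dual (Restr ρ S) D) := .dual hF hI hl
    let i' : Restr ρ I →ₗ[Tᵐᵒᵖ] Dual (Restr ρ S) D := restrMapOp ρ (X := I) (Y := Dual S D) i
    let r' : Dual (Restr ρ S) D →ₗ[Tᵐᵒᵖ] Restr ρ I := restrMapOp ρ (X := Dual S D) (Y := I) r
    have hI'' : TensorExact d (Restr ρ I) := .retract i' r'
      (LinearMap.ext fun x => LinearMap.congr_fun hri x) hN
    exact hI''.extend ρ

/-! ### Modules over triangular matrix rings -/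

section Triangular

variable {A B U : Type u} [Ring A] [Ring B] [AddCommGroup U] [Module B U] [Module Aᵐᵒᵖ U]
  [SMulCommClass B Aᵐᵒᵖ U]

variable (A B U) in
/-- The projection of the triangular matrix ring onto its upper left corner. -/
def projA : TriRing A B U →+* A where
  toFun := TriRing.a
  map_one' := rfl
  map_mul' _ _ := rfl
  map_zero' := rfl
  map_add' _ _ := rfl

variable (A B U) in
/-- The projection of the triangular matrix ring onto its lower right corner. -/
def projB : TriRing A B U →+* B where
  toFun := TriRing.b
  map_one' := rfl
  map_mul' _ _ := rfl
  map_zero' := rfl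
  map_add' _ _ := rfl

instance : Module.Projective (TriRing A B U)ᵐᵒᵖ (TriRing A B U) :=
  .of_equiv' (MulOpposite.opLinearEquiv (TriRing A B U)ᵐᵒᵖ).symm

-- As a right module, `A` is the top row of `T`, a direct summand.
variable (A B U) in
theorem projective_projA :
    Module.Projective (TriRing A B U)ᵐᵒᵖ (Restr (projA A B U) A) := by
  let i : Restr (projA A B U) A →ₗ[(TriRing A B U)ᵐᵒᵖ] TriRing A B U :=
    { toFun := fun a => ⟨(show A from a), 0, 0⟩
      map_add' := fun a a' => TriRing.ext rfl (add_zero (0 : U)).symm (add_zero (0 : B)).symm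
      map_smul' := fun t a => TriRing.ext rfl
        (by simp [MulOpposite.smul_eq_mul_unop]) (zero_mul t.unop.b).symm }
  let r : TriRing A B U →ₗ[(TriRing A B U)ᵐᵒᵖ] Restr (projA A B U) A :=
    { toFun := TriRing.a
      map_add' := fun _ _ => rfl
      map_smul' := fun _ _ => rfl }
  exact .of_split i r rfl

-- As a left module, `B` is the last column of `T`, a direct summand.
variable (A B U) in
theorem projective_projB : Module.Projective (TriRing A B U) (Restr (projB A B U) B) := by
  let i : Restr (projB A B U) B →ₗ[TriRing A B U] TriRing A B U :=
    { toFun := fun b => ⟨0, 0, (show B from b)⟩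
      map_add' := fun a a' => TriRing.ext (add_zero (0 : A)).symm (add_zero (0 : U)).symm rfl
      map_smul' := fun t a => TriRing.ext (mul_zero t.a).symm (by simp) rfl }
  let r : TriRing A B U →ₗ[TriRing A B U] Restr (projB A B U) B :=
    { toFun := TriRing.b
      map_add' := fun _ _ => rfl
      map_smul' := fun _ _ => rfl }
  exact .of_split i r rfl

theorem FinitePD.restr_projA {X : Type u} [AddCommGroup X] [Module Aᵐᵒᵖ X]
    (hX : FinitePD (ModuleCat.of Aᵐᵒᵖ X)) :
    FinitePD (ModuleCat.of (TriRing A B U)ᵐᵒᵖ (Restr (projA A B U) X)) := by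
  refine FinitePD.restr (projA A B U).op ?_ hX
  have := projective_projA A B U
  let e : Restr (projA A B U) A ≃ₗ[(TriRing A B U)ᵐᵒᵖ] Restr (projA A B U).op Aᵐᵒᵖ :=
    { (MulOpposite.opAddEquiv : A ≃+ Aᵐᵒᵖ) with
      map_smul' := fun _ _ => rfl }
  exact .of_equiv' e

theorem FinitePD.restr_projB {X : Type u} [AddCommGroup X] [Module B X]
    (hX : FinitePD (ModuleCat.of B X)) :
    FinitePD (ModuleCat.of (TriRing A B U) (Restr (projB A B U) X)) :=
  FinitePD.restr (projB A B U) (projective_projB A B U) hX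

variable (A B U) in
theorem finitePD_projA_right :
    FinitePD (ModuleCat.of (TriRing A B U)ᵐᵒᵖ (Restr (projA A B U) A)) :=
  have := projective_projA A B U
  .of_projective

variable (A B U) in
theorem finitePD_projB_left :
    FinitePD (ModuleCat.of (TriRing A B U) (Restr (projB A B U) B)) :=
  have := projective_projB A B U
  .of_projective

/-- The kernel of `T → B` is the first column `A ⊕ U`, on which `T` acts from the right through `A`.
-/
theorem finitePD_projB_right (hUA : FinitePD (ModuleCat.of Aᵐᵒᵖ U)) :
    FinitePD (ModuleCat.of (TriRing A B U)ᵐᵒᵖ (Restr (projB A B U) B)) := by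
  have : Module.Projective Aᵐᵒᵖ A := .of_equiv' (MulOpposite.opLinearEquiv Aᵐᵒᵖ).symm
  have h : FinitePD (ModuleCat.of (TriRing A B U)ᵐᵒᵖ (Restr (projA A B U) (A × U))) :=
    (FinitePD.prod .of_projective hUA).restr_projA
  let f : Restr (projA A B U) (A × U) →ₗ[(TriRing A B U)ᵐᵒᵖ] TriRing A B U :=
    { toFun := fun p => ⟨(show A × U from p).1, (show A × U from p).2, 0⟩
      map_add' := fun _ _ => TriRing.ext rfl rfl (add_zero (0 : B)).symm
      map_smul' := fun t p => TriRing.ext rfl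
        (by
          change _ = MulOpposite.op t.unop.a • (show A × U from p).2 + (0 : B) • t.unop.u
          rw [zero_smul, add_zero]
          rfl) (zero_mul t.unop.b).symm }
  let g : TriRing A B U →ₗ[(TriRing A B U)ᵐᵒᵖ] Restr (projB A B U) B :=
    { toFun := TriRing.b
      map_add' := fun _ _ => rfl
      map_smul' := fun _ _ => rfl }
  refine FinitePD.third (f := f) (g := g)
    (fun p q hpq => Prod.ext (congrArg TriRing.a hpq) (congrArg TriRing.u hpq)) (fun t => ?_)
    (fun b => ⟨⟨0, 0, b⟩, rfl⟩) h .of_projective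
  exact ⟨fun ht => ⟨((t.a, t.u) : A × U), TriRing.ext rfl rfl ht.symm⟩, by
    rintro ⟨p, rfl⟩
    rfl⟩

/-- The kernel of `T → A` is the bottom row `U ⊕ B`, on which `T` acts from the left through `B`. -/
theorem finitePD_projA_left (hBU : FinitePD (ModuleCat.of B U)) :
    FinitePD (ModuleCat.of (TriRing A B U) (Restr (projA A B U) A)) := by
  have h : FinitePD (ModuleCat.of (TriRing A B U) (Restr (projB A B U) (U × B))) :=
    (FinitePD.prod hBU .of_projective).restr_projB
  let f : Restr (projB A B U) (U × B) →ₗ[TriRing A B U] TriRing A B U :=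
    { toFun := fun p => ⟨0, (show U × B from p).1, (show U × B from p).2⟩
      map_add' := fun _ _ => TriRing.ext (add_zero (0 : A)).symm rfl rfl
      map_smul' := fun t p => TriRing.ext (mul_zero t.a).symm
        (by
          change _ = MulOpposite.op (0 : A) • t.u + t.b • (show U × B from p).1
          rw [MulOpposite.op_zero, zero_smul, zero_add]
          rfl) rfl }
  let g : TriRing A B U →ₗ[TriRing A B U] Restr (projA A B U) A :=
    { toFun := TriRing.a
      map_add' := fun _ _ => rfl
      map_smul' := fun _ _ => rfl }
  refine FinitePD.third (f := f) (g := g)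
    (fun p q hpq => Prod.ext (congrArg TriRing.u hpq) (congrArg TriRing.b hpq)) (fun t => ?_)
    (fun a => ⟨⟨a, 0, 0⟩, rfl⟩) h .of_projective
  exact ⟨fun ht => ⟨((t.u, t.b) : U × B), TriRing.ext ht.symm rfl rfl⟩, by
    rintro ⟨p, rfl⟩
    rfl⟩

variable {M₁ M₂ : Type u} [AddCommGroup M₁] [Module A M₁] [AddCommGroup M₂] [Module B M₂]
  (φ : BalTensor A U M₁ →ₗ[B] M₂)

/-- The column `(m₁; m₂)`. -/
def column (m₁ : M₁) (m₂ : M₂) : TriModule φ := (m₁, m₂)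

theorem column_add (m m' : M₁) (n n' : M₂) :
    column φ (m + m') (n + n') = column φ m n + column φ m' n' := rfl

theorem smul_column (t : TriRing A B U) (m : M₁) (n : M₂) :
    t • column φ m n = column φ (t.a • m) (φ (btmul A t.u m) + t.b • n) := rfl

/-- `A ⊗_T M ≅ M₁` for a module `M = (M₁, M₂, φ)` over `T = (A 0; U B)`. -/
def extendProjA : BalTensor (TriRing A B U) (Restr (projA A B U) A) (TriModule φ) ≃ₗ[A] M₁ :=
  let ρ := projA A B U
  let f : BalTensor (TriRing A B U) (Restr ρ A) (TriModule φ) →ₗ[A] M₁ :=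
    { balLift
        (AddMonoidHom.mk' (fun a => AddMonoidHom.mk'
          (fun m : TriModule φ => (toRestr ρ A).symm a • m.1) fun m n => by simp)
          fun a a' => AddMonoidHom.ext fun m => by simp [add_smul])
        fun a t m => mul_smul ((toRestr ρ A).symm a) t.a m.1 with
      map_smul' := fun a t => by
        change balLift _ _ (a • t) = a • balLift _ _ t
        induction t using balTensor_induction with
        | zero => simp only [smul_zero, map_zero]
        | add s t hs ht => simp only [smul_add, map_add, hs, ht]
        | tmul a' m => exact mul_smul a ((toRestr ρ A).symm a') m.1 }
  { f with
    invFun := fun m => btmul (TriRing A B U) (toRestr ρ A 1) (column φ m 0)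
    left_inv := fun t => by
      change btmul (TriRing A B U) (toRestr ρ A 1) (column φ (f t) 0) = t
      induction t using balTensor_induction with
      | zero =>
        rw [map_zero]
        exact btmul_zero _
      | add s t hs ht =>
        conv_rhs => rw [← hs, ← ht]
        rw [map_add, ← btmul_add, ← column_add, add_zero]
      | tmul a m =>
        obtain ⟨a, rfl⟩ := (toRestr ρ A).surjective a
        -- The matrix with single entry `a` kills the second coordinate of `m`, and it can be moved
        -- across the tensor sign.
        have h : column φ (a • m.1) 0 = (⟨a, 0, 0⟩ : TriRing A B U) • m := by
          refine Prod.ext rfl ?_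
          change 0 = φ (btmul A 0 m.1) + (0 : B) • m.2
          simp
        change btmul (TriRing A B U) (toRestr ρ A 1) (column φ (a • m.1) 0) = _
        rw [h, ← btmul_balanced]
        exact congrArg (fun x => btmul (TriRing A B U) (toRestr ρ A x) m) (one_mul a)
    right_inv := fun m => one_smul A m }

/-- `B ⊗_T M ≅ M₂ / Im φ` for a module `M = (M₁, M₂, φ)` over `T = (A 0; U B)`. -/
def extendProjB : BalTensor (TriRing A B U) (Restr (projB A B U) B) (TriModule φ) ≃ₗ[B]
    M₂ ⧸ LinearMap.range φ :=
  let ρ := projB A B U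
  let f : BalTensor (TriRing A B U) (Restr ρ B) (TriModule φ) →ₗ[B] M₂ ⧸ LinearMap.range φ :=
    { balLift
        (AddMonoidHom.mk' (fun b => AddMonoidHom.mk'
          (fun m : TriModule φ => (toRestr ρ B).symm b • (LinearMap.range φ).mkQ m.2)
            fun m n => by simp)
          fun b b' => AddMonoidHom.ext fun m => by simp [add_smul])
        fun b t m => by
          have h : (LinearMap.range φ).mkQ (φ (btmul A t.u m.1)) = 0 :=
            (Submodule.Quotient.mk_eq_zero _).2 ⟨_, rfl⟩
          obtain ⟨b, rfl⟩ := (toRestr ρ B).surjective b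
          change (b * t.b) • (LinearMap.range φ).mkQ m.2 =
            b • (LinearMap.range φ).mkQ (φ (btmul A t.u m.1) + t.b • m.2)
          rw [map_add, h, zero_add, map_smul, mul_smul] with
      map_smul' := fun b t => by
        change balLift _ _ (b • t) = b • balLift _ _ t
        induction t using balTensor_induction with
        | zero => simp only [smul_zero, map_zero]
        | add s t hs ht => simp only [smul_add, map_add, hs, ht]
        | tmul b' m => exact mul_smul b ((toRestr ρ B).symm b') ((LinearMap.range φ).mkQ m.2) }
  let g : M₂ →ₗ[B] BalTensor (TriRing A B U) (Restr ρ B) (TriModule φ) :=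
    { toFun := fun m => btmul (TriRing A B U) (toRestr ρ B 1) (column φ 0 m)
      map_add' := fun m n => by rw [← btmul_add, ← column_add, add_zero]
      map_smul' := fun b m => by
        have h : column φ 0 (b • m) = (⟨0, 0, b⟩ : TriRing A B U) • column φ 0 m := by
          simp [smul_column]
        rw [h, ← btmul_balanced]
        exact congrArg (fun x => btmul (TriRing A B U) (toRestr ρ B x) (column φ 0 m))
          ((one_mul b).trans (mul_one b).symm) }
  have hg : LinearMap.range φ ≤ LinearMap.ker g := by
    rintro _ ⟨t, rfl⟩
    refine balTensor_congr (g.toAddMonoidHom.comp φ.toAddMonoidHom) 0 (fun u m => ?_) t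
    -- Elements of `Im φ` come from matrices with single entry `u`, and these act as zero on `B`
    -- from the right.
    have h : column φ 0 (φ (btmul A u m)) = (⟨0, u, 0⟩ : TriRing A B U) • column φ m 0 := by
      simp [smul_column]
    change btmul (TriRing A B U) (toRestr ρ B 1) (column φ 0 (φ (btmul A u m))) = 0
    rw [h, ← btmul_balanced, op_smul_toRestr]
    refine (congrArg (fun x => btmul (TriRing A B U) (toRestr ρ B x) (column φ m 0))
      (mul_zero (1 : B))).trans ?_
    rw [map_zero, zero_btmul]
  LinearEquiv.ofLinearMap f ((LinearMap.range φ).liftQ g hg)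
    (Submodule.linearMap_qext _ (LinearMap.ext fun m => one_smul B ((LinearMap.range φ).mkQ m)))
    (LinearMap.ext fun t => by
      refine balTensor_congr (((LinearMap.range φ).liftQ g hg).toAddMonoidHom.comp
        f.toAddMonoidHom) (AddMonoidHom.id _) (fun b m => ?_) t
      obtain ⟨b, rfl⟩ := (toRestr ρ B).surjective b
      have h : column φ 0 (b • m.2) = (⟨0, 0, b⟩ : TriRing A B U) • m := by
        refine Prod.ext (zero_smul A m.1).symm ?_
        change b • m.2 = φ (btmul A 0 m.1) + b • m.2
        simp
      change btmul (TriRing A B U) (toRestr ρ B 1) (column φ 0 (b • m.2)) = _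
      rw [h, ← btmul_balanced]
      exact congrArg (fun x => btmul (TriRing A B U) (toRestr ρ B x) m) (one_mul b))

theorem IsGorensteinFlat.injective_triModule (hUA : FinitePD (ModuleCat.of Aᵐᵒᵖ U))
    (hM : IsGorensteinFlat (TriRing A B U) (TriModule φ)) : Function.Injective φ := by
  obtain ⟨F, d, hF, hd, ⟨e⟩, -⟩ := hM
  let T := TriRing A B U
  have hU : TensorExact d (Restr (projA A B U) U) := .of_finitePD hF hd hUA.restr_projA
  let i : Restr (projA A B U) U →ₗ[Tᵐᵒᵖ] T :=
    { toFun := fun u => ⟨0, u, 0⟩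
      map_add' := fun _ _ => TriRing.ext (add_zero (0 : A)).symm rfl (add_zero (0 : B)).symm
      map_smul' := fun t u => TriRing.ext (zero_mul t.unop.a).symm
        (by
          change _ = MulOpposite.op t.unop.a • (show U from u) + (0 : B) • t.unop.u
          rw [zero_smul, add_zero]
          rfl) (zero_mul t.unop.b).symm }
  have hi : Function.Injective i := fun u u' h => congrArg TriRing.u h
  let j : TriModule φ →ₗ[T] F 0 := (LinearMap.ker (d 0)).subtype ∘ₗ e.toLinearMap
  have hj : Function.Injective
      (bmap (LinearMap.id : Restr (projA A B U) U →ₗ[Tᵐᵒᵖ] _) j) := by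
    have he : Function.Injective
        (bmap (LinearMap.id : Restr (projA A B U) U →ₗ[Tᵐᵒᵖ] _) e.toLinearMap) := by
      refine Function.LeftInverse.injective (g := bmap LinearMap.id e.symm.toLinearMap) fun t => ?_
      rw [bmap_bmap, LinearEquiv.symm_comp, LinearMap.id_comp, bmap_id]
    intro s t h
    refine he ((hU.cycles hd 0).1 ?_)
    rw [bmap_bmap, bmap_bmap]
    exact h
  -- In the square from `U ⊗ M` to `T ⊗ F 0`, the path through `U ⊗ F 0` is injective, hence so is
  -- the first map `U ⊗ M → T ⊗ M` of the other path.
  have hij : Function.Injective (bmap i (LinearMap.id : TriModule φ →ₗ[T] _)) := by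
    intro s t h
    refine hj (hF 0 _ _ i hi ?_)
    rw [bmap_comm, bmap_comm, h]
  -- This compares `U ⊗_A M₁` with `U ⊗_T M`; only injectivity of `k` is needed, so the left inverse
  -- `l` suffices.
  let k : BalTensor A U M₁ →+ BalTensor T (Restr (projA A B U) U) (TriModule φ) := balLift
    (AddMonoidHom.mk' (fun u => AddMonoidHom.mk'
      (fun m => btmul T (toRestr (projA A B U) U u) (column φ m 0))
        fun m n => by rw [← btmul_add, ← column_add, add_zero])
      fun u u' => AddMonoidHom.ext fun m => by
        simp only [map_add, add_btmul, AddMonoidHom.mk'_apply, AddMonoidHom.add_apply])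
    fun u a m => by
      refine (btmul_balanced (toRestr (projA A B U) U u) (⟨a, 0, 0⟩ : T)
        (column φ m 0)).trans (congrArg (btmul T _) ?_)
      simp [smul_column]
  let l : BalTensor T (Restr (projA A B U) U) (TriModule φ) →+ BalTensor A U M₁ := balLift
    (AddMonoidHom.mk' (fun u => AddMonoidHom.mk'
      (fun m : TriModule φ => btmul A ((toRestr (projA A B U) U).symm u) m.1)
        fun m n => btmul_add _ m.1 n.1)
      fun u u' => AddMonoidHom.ext fun m => add_btmul _ _ m.1)
    fun u t m => btmul_balanced ((toRestr (projA A B U) U).symm u) t.a m.1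
  have hk : Function.Injective k := Function.LeftInverse.injective (g := l)
    (balTensor_congr (l.comp k) (AddMonoidHom.id _) fun _ _ => rfl)
  have hφ t : ringBalTensor (bmap i (LinearMap.id : TriModule φ →ₗ[T] _) (k t)) =
      column φ 0 (φ t) :=
    balTensor_congr ((ringBalTensor (R := T) (Y := TriModule φ)).toAddMonoidHom.comp
      ((bmap i LinearMap.id).comp k)) ((AddMonoidHom.inr M₁ M₂).comp φ.toAddMonoidHom)
      (fun u m => Prod.ext (zero_smul A m) (by
        change φ (btmul A u m) + (0 : B) • (0 : M₂) = φ (btmul A u m)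
        simp)) t
  refine fun s t h => hk (hij (ringBalTensor.injective ?_))
  rw [hφ, hφ, h]

end Triangular

end GorTri

theorem proposition3p6 {A B U : Type u} [Ring A] [Ring B] [AddCommGroup U] [Module B U]
    [Module Aᵐᵒᵖ U] [SMulCommClass B Aᵐᵒᵖ U]
    (hUA : FinitePD (ModuleCat.of Aᵐᵒᵖ U)) (hBU : FinitePD (ModuleCat.of B U))
    (hT : IsRightGorensteinRegular (TriRing A B U))
    {M₁ M₂ : Type u} [AddCommGroup M₁] [Module A M₁] [AddCommGroup M₂] [Module B M₂]
    (φ : BalTensor A U M₁ →ₗ[B] M₂)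
    (hM : IsGorensteinFlat (TriRing A B U) (TriModule φ)) :
    IsGorensteinFlat A M₁ ∧ IsGorensteinFlat B (M₂ ⧸ LinearMap.range φ) ∧
      Function.Injective φ :=
  ⟨.of_equiv (extendProjA φ) (hM.extend _ (finitePD_projA_left hBU) (finitePD_projA_right A B U)),
    .of_equiv (extendProjB φ) (hM.extend _ (finitePD_projB_left A B U) (finitePD_projB_right hUA)),
    hM.injective_triModule φ hUA⟩
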